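/- Work in $\mathbb{R}^n$, $n\ge 1$, with the standard inner product $\langle\cdot,\cdot\rangle$ and Euclidean norm $|\cdot|$; $|A|$ also denotes the Lebesgue measure of a set $A$. A convex body is a compact convex set with nonempty interior, and $m_A$ is the uniform probability measure on $A$. For Borel probability measures $\mu,\nu$ on $\mathbb{R}^n$ let $W_1(\mu,\nu)=\inf_\pi\int|x-y|\,d\pi(x,y)$, where $\pi$ runs over the probability measures on $\mathbb{R}^n\times\mathbb{R}^n$ with marginals $\mu$ and $\nu$, and for $\nu\ll\mu$ let $H(\nu|\mu)=\int\log\frac{d\nu}{d\mu}\,d\nu$. Let $\tau_1(\mu)\in[0,\infty]$ be the largest constant $\tau$ such that $W_1(\mu,\nu)\le\sqrt{\frac{2}{\tau}H(\nu|\mu)}$ for every Borel probability measure $\nu\ll\mu$. A convex body $K$ is isotropic if its centroid is $0$, $|K|=1$, and there is a constant $L_K>0$ with $\int_K\langle x,y\rangle^2\,dx=L_K^2|y|^2$ for all $y\in\mathbb{R}^n$; the isotropic constant of an arbitrary convex body $K$ is $L_K=L_{T(K)}$, where $T$ is an invertible affine map such that $T(K)$ is isotropic. The volume ratio of $K$ in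 $B$ is $\mathrm{vr}(B,K)=\min_T\left(|B|/|T(K)|\right)^{1/n}$, where $T$ runs over the invertible affine maps of $\mathbb{R}^n$ with $T(K)\subset B$. There is an absolute constant $c>0$ such that for every $n\ge 1$ and all convex bodies $K,B\subset\mathbb{R}^n$ with $B$ isotropic, $$L_K\le c\left(1+\sqrt{\log v}\right)v\,\tau^{-1/2},$$ where $v=\mathrm{vr}(B,K)$ and $\tau=\tau_1(m_B)$ (with $0^{-1/2}=\infty$ and $\infty^{-1/2}=0$). -/

import Mathlib

open MeasureTheory
open scoped ENNReal

noncomputable section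

namespace Slicing

/-- The uniform probability measure `m_A(B) = |A ∩ B| / |A|` on a set `A ⊆ ℝⁿ`
with `0 < |A| < ∞`. -/
def uniformMeasure {n : ℕ} (A : Set (EuclideanSpace ℝ (Fin n))) :
    Measure (EuclideanSpace ℝ (Fin n)) :=
  ProbabilityTheory.cond volume A

/-- The couplings of `μ` and `ν`: the probability measures on `ℝⁿ × ℝⁿ` with
marginals `μ` and `ν`. -/
def couplings {n : ℕ} (μ ν : Measure (EuclideanSpace ℝ (Fin n))) :
    Set (Measure (EuclideanSpace ℝ (Fin n) × EuclideanSpace ℝ (Fin n))) :=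
  {π | IsProbabilityMeasure π ∧ π.map Prod.fst = μ ∧ π.map Prod.snd = ν}

/-- The `L_p` Wasserstein distance `W_p(μ, ν) = inf_π (∫ |x - y|^p dπ(x, y))^{1/p}`, `p ≥ 1`,
with values in `[0, ∞]`. -/
def wassersteinDist {n : ℕ} (p : ℝ) (μ ν : Measure (EuclideanSpace ℝ (Fin n))) : ℝ≥0∞ :=
  ⨅ π ∈ couplings μ ν, (∫⁻ z, edist z.1 z.2 ^ p ∂π) ^ (1 / p)

/-- The `L_p` transportation cost constant `τ_p(μ)`: the largest `τ ∈ [0, ∞]` such that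
`W_p(μ, ν) ≤ √((2 / τ) H(ν | μ))` for every Borel probability measure `ν ≪ μ`.
The relative entropy `H(ν | μ) = ∫ log (dν/dμ) dν ∈ [0, ∞]` is `InformationTheory.klDiv ν μ`. -/
def transportCostConst {n : ℕ} (p : ℝ) (μ : Measure (EuclideanSpace ℝ (Fin n))) : ℝ≥0∞ :=
  sSup {τ : ℝ≥0∞ | ∀ ν : Measure (EuclideanSpace ℝ (Fin n)), IsProbabilityMeasure ν → ν ≪ μ →
    wassersteinDist p μ ν ≤ (2 / τ * InformationTheory.klDiv ν μ) ^ (1 / 2 : ℝ)}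

/-- `K` is in isotropic position with constant `L`: its centroid is `0`, its volume is `1`,
`L > 0`, and `∫_K ⟨x, y⟩² dx = L² |y|²` for all `y`. -/
structure IsIsotropicWith {n : ℕ} (K : Set (EuclideanSpace ℝ (Fin n))) (L : ℝ) : Prop where
  centroid_eq_zero : ∫ x in K, x = 0
  volume_eq_one : volume K = 1
  const_pos : 0 < L
  second_moment : ∀ y : EuclideanSpace ℝ (Fin n), ∫ x in K, (inner ℝ x y) ^ 2 = L ^ 2 * ‖y‖ ^ 2

/-- `K` is isotropic. -/
def IsIsotropic {n : ℕ} (K : Set (EuclideanSpace ℝ (Fin n))) : Prop :=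
  ∃ L : ℝ, IsIsotropicWith K L

/-- The isotropic constant `L_K` of a convex body `K`: the constant `L_{T(K)}` of an isotropic
affine image `T(K)` of `K`. Such an image exists, and its constant does not depend on `T`
(for `n ≥ 1`), so the supremum is over a set with exactly one element. -/
def isotropicConstant {n : ℕ} (K : Set (EuclideanSpace ℝ (Fin n))) : ℝ :=
  sSup {L : ℝ | ∃ T : EuclideanSpace ℝ (Fin n) ≃ᵃ[ℝ] EuclideanSpace ℝ (Fin n),
    IsIsotropicWith (T '' K) L}

/-- The volume ratio `vr(B, K)` of `K` in `B`: the minimum of `(|B| / |T(K)|)^{1/n}` over the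
affine transformations `T` of `ℝⁿ` with `T(K) ⊆ B`. -/
def volumeRatio {n : ℕ} (B K : Set (EuclideanSpace ℝ (Fin n))) : ℝ :=
  sInf {r : ℝ | ∃ T : EuclideanSpace ℝ (Fin n) ≃ᵃ[ℝ] EuclideanSpace ℝ (Fin n),
    T '' K ⊆ B ∧ r = (volume.real B / volume.real (T '' K)) ^ (1 / (n : ℝ))}

end Slicing

end

namespace Slicing

open InformationTheory ProbabilityTheory

variable {n : ℕ}

/-! Place an affine copy `A` of `K` inside `B`, of volume `δ = q⁻ⁿ`, and estimate `∫_A |x|²` twice.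
Isotropic position minimises the second moment at given volume, so it is at least `δ n L_K² / q²`
(`IsIsotropicWith.le_setIntegral_norm_sq`). Conversely, the transport inequality with constant `r`
makes `|x|` subgaussian on `B`: on a subset of volume `δ` it exceeds its mean by little more than
`√((2 / r) log (1 / δ))` in mean square (`SatisfiesT1.setLIntegral_sq_le`). The mean itself is at
most `√n L_B`, and the same concentration, applied to linear functionals, gives `L_B² ≤ 4 / r`.
Since `log (1 / δ) = n log q`, both contributions have order `n`, and dividing by `n` leaves `L_K² r
≤ (18 + 6 log q) q²`. It remains to take the infimum over `q` and the supremum over `r`. -/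

/-! ### Transport cost and entropy -/

/-- The easy half of Kantorovich duality: integrals of a `1`-Lipschitz function against two
measures differ by at most their `L₁` Wasserstein distance. -/
theorem edist_integral_le_wassersteinDist {μ ν : Measure (EuclideanSpace ℝ (Fin n))}
    {g : EuclideanSpace ℝ (Fin n) → ℝ} (hg : LipschitzWith 1 g) (hμ : Integrable g μ)
    (hν : Integrable g ν) : edist (∫ x, g x ∂μ) (∫ x, g x ∂ν) ≤ wassersteinDist 1 μ ν := by
  refine le_iInf₂ fun π hπ => ?_
  obtain ⟨-, rfl, rfl⟩ := hπ
  have hgm : Measurable g := hg.continuous.measurable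
  rw [integral_map measurable_fst.aemeasurable hgm.aestronglyMeasurable,
    integral_map measurable_snd.aemeasurable hgm.aestronglyMeasurable]
  simp only [ENNReal.rpow_one, div_one]
  refine (edist_integral_le_lintegral_edist (hμ.comp_measurable measurable_fst)
    (hν.comp_measurable measurable_snd)).trans (lintegral_mono fun z => ?_)
  simpa using hg z.1 z.2

/-- The relative entropy of a conditioned measure. -/
theorem klDiv_cond {α : Type*} [MeasurableSpace α] {μ : Measure α} [IsProbabilityMeasure μ]
    {D : Set α} (hD : MeasurableSet D) (h0 : μ D ≠ 0) :
    klDiv (ProbabilityTheory.cond μ D) μ = ENNReal.ofReal (-Real.log (μ.real D)) := by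
  have hP : IsProbabilityMeasure (ProbabilityTheory.cond μ D) := cond_isProbabilityMeasure h0
  have hac : ProbabilityTheory.cond μ D ≪ μ := cond_absolutelyContinuous
  have hllr : llr (ProbabilityTheory.cond μ D) μ =ᵐ[ProbabilityTheory.cond μ D]
      fun _ => -Real.log (μ.real D) := by
    have h1 : (ProbabilityTheory.cond μ D).rnDeriv μ =ᵐ[μ]
        (μ D)⁻¹ • D.indicator 1 := by
      refine (Measure.rnDeriv_smul_left_of_ne_top (μ.restrict D) μ
        (ENNReal.inv_ne_top.2 h0)).trans ?_
      filter_upwards [Measure.rnDeriv_restrict_self μ hD] with x hx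
      simp only [Pi.smul_apply, hx]
    filter_upwards [hac.ae_le h1, ae_cond_mem hD] with x hx hxD
    simp [llr, hx, hxD, Measure.real]
  rw [klDiv_of_ac_of_integrable hac ((integrable_const _).congr hllr.symm),
    integral_congr_ae hllr]
  simp

/-- The `L₁` transportation cost inequality with constant `τ`. -/
def SatisfiesT1 (μ : Measure (EuclideanSpace ℝ (Fin n))) (τ : ℝ≥0∞) : Prop :=
  ∀ ν : Measure (EuclideanSpace ℝ (Fin n)), IsProbabilityMeasure ν → ν ≪ μ →
    wassersteinDist 1 μ ν ≤ (2 / τ * klDiv ν μ) ^ (1 / 2 : ℝ)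

theorem SatisfiesT1.mono {μ : Measure (EuclideanSpace ℝ (Fin n))} {σ τ : ℝ≥0∞}
    (h : SatisfiesT1 μ τ) (hστ : σ ≤ τ) : SatisfiesT1 μ σ := fun ν hν hac =>
  (h ν hν hac).trans (by gcongr)

/-! ### Gaussian concentration from the transport inequality -/

section Concentration

variable {μ : Measure (EuclideanSpace ℝ (Fin n))} [IsProbabilityMeasure μ] {r : ℝ}
  {g : EuclideanSpace ℝ (Fin n) → ℝ}

/-- Gaussian concentration from the transportation cost inequality (Marton's argument). -/
theorem SatisfiesT1.measureReal_le (hT : SatisfiesT1 μ (ENNReal.ofReal r)) (hr : 0 < r)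
    (hg : LipschitzWith 1 g) (hgi : Integrable g μ) {D : Set (EuclideanSpace ℝ (Fin n))}
    (hD : MeasurableSet D) {t : ℝ} (ht : ∫ x, g x ∂μ ≤ t) (hgD : ∀ x ∈ D, t ≤ g x) :
    μ.real D ≤ Real.exp (-(r * (t - ∫ x, g x ∂μ) ^ 2 / 2)) := by
  by_cases h0 : μ D = 0
  · simp [Measure.real, h0, Real.exp_nonneg]
  have hP : IsProbabilityMeasure (ProbabilityTheory.cond μ D) := cond_isProbabilityMeasure h0
  have hpos : 0 < μ.real D := ENNReal.toReal_pos h0 (measure_ne_top _ _)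
  have hle1 : μ.real D ≤ 1 := measureReal_le_one
  have hgi' : Integrable g (ProbabilityTheory.cond μ D) :=
    hgi.restrict.smul_measure (ENNReal.inv_ne_top.2 h0)
  have hmean : t ≤ ∫ x, g x ∂(ProbabilityTheory.cond μ D) := by
    calc t = ∫ _, t ∂(ProbabilityTheory.cond μ D) := by simp
      _ ≤ _ := by
        refine integral_mono_ae (integrable_const _) hgi' ?_
        filter_upwards [ae_cond_mem hD] with x hx using hgD x hx
  have hlog : 0 ≤ -Real.log (μ.real D) := by
    have := Real.log_nonpos hpos.le hle1
    linarith
  -- Test the inequality on `μ` conditioned on `D`: this moves the mean of `g` to at least `t`, at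
  -- entropy cost `-log μ(D)`.
  have key : ENNReal.ofReal (t - ∫ x, g x ∂μ) ≤
      ENNReal.ofReal ((2 / r * -Real.log (μ.real D)) ^ (1 / 2 : ℝ)) := by
    calc ENNReal.ofReal (t - ∫ x, g x ∂μ)
        ≤ edist (∫ x, g x ∂μ) (∫ x, g x ∂(ProbabilityTheory.cond μ D)) := by
          rw [edist_dist, Real.dist_eq]
          refine ENNReal.ofReal_le_ofReal ?_
          rw [abs_sub_comm]
          exact (sub_le_sub_right hmean _).trans (le_abs_self _)
      _ ≤ wassersteinDist 1 μ (ProbabilityTheory.cond μ D) :=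
          edist_integral_le_wassersteinDist hg hgi hgi'
      _ ≤ (2 / ENNReal.ofReal r * klDiv (ProbabilityTheory.cond μ D) μ) ^ (1 / 2 : ℝ) :=
          hT _ hP cond_absolutelyContinuous
      _ = _ := by
          rw [klDiv_cond hD h0, ← ENNReal.ofReal_rpow_of_nonneg (by positivity) (by norm_num),
            ENNReal.ofReal_mul (by positivity), ENNReal.ofReal_div_of_pos hr]
          norm_num
  rw [ENNReal.ofReal_le_ofReal_iff (by positivity), ← Real.sqrt_eq_rpow] at key
  have hsq : (t - ∫ x, g x ∂μ) ^ 2 ≤ 2 / r * -Real.log (μ.real D) :=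
    (Real.le_sqrt (by linarith) (by positivity)).1 key
  rw [← Real.log_le_iff_le_exp hpos]
  have : r * (t - ∫ x, g x ∂μ) ^ 2 ≤ r * (2 / r * -Real.log (μ.real D)) := by gcongr
  rw [show r * (2 / r * -Real.log (μ.real D)) = -2 * Real.log (μ.real D) by field_simp] at this
  linarith

theorem integral_Ioi_mul_exp_neg_mul_sq (hr : 0 < r) :
    ∫ t in Set.Ioi (0 : ℝ), Real.exp (-(r * t ^ 2 / 2)) * t = 1 / r := by
  have h := _root_.integral_rpow_mul_exp_neg_mul_rpow (p := 2) (q := 1) (b := r / 2)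
    (by norm_num) (by norm_num) (by positivity)
  norm_num at h
  rw [← setIntegral_congr_fun measurableSet_Ioi (f := fun x => x * Real.exp (-(r / 2 * x ^ 2))),
    h, Real.rpow_neg_one]
  · field_simp
  · intro x _
    simp only []
    rw [mul_comm]
    ring_nf

theorem integrableOn_Ioi_mul_exp_neg_mul_sq (hr : 0 < r) :
    IntegrableOn (fun t : ℝ => Real.exp (-(r * t ^ 2 / 2)) * t) (Set.Ioi 0) := by
  -- A non-integrable function would have integral `0`, not `1 / r`.
  by_contra h
  have := integral_Ioi_mul_exp_neg_mul_sq hr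
  rw [integral_undef h] at this
  have : 0 < 1 / r := by positivity
  linarith

/-- Under the transportation cost inequality, on a set `A` of probability `p` the excess of a
`1`-Lipschitz function over its mean plus `√((2 / r) log (1 / p))` is small in mean square. -/
theorem SatisfiesT1.setLIntegral_sq_le (hT : SatisfiesT1 μ (ENNReal.ofReal r)) (hr : 0 < r)
    (hg : LipschitzWith 1 g) (hgi : Integrable g μ) {A : Set (EuclideanSpace ℝ (Fin n))}
    (hA : MeasurableSet A) (hA0 : 0 < μ.real A) {a : ℝ} (ha : 0 ≤ a)
    (ha2 : r * a ^ 2 = -2 * Real.log (μ.real A)) :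
    ∫⁻ x in A, ENNReal.ofReal (max (g x - (∫ y, g y ∂μ) - a) 0 ^ 2) ∂μ ≤
      ENNReal.ofReal (2 / r * μ.real A) := by
  set m := ∫ y, g y ∂μ with hm
  have hgm : Measurable g := hg.continuous.measurable
  have hfm : Measurable fun x => max (g x - m - a) 0 := by fun_prop
  have hlc := lintegral_rpow_eq_lintegral_meas_lt_mul (μ.restrict A)
    (f := fun x => max (g x - m - a) 0) (ae_of_all _ fun x => le_max_right _ _)
    hfm.aemeasurable (p := 2) (by norm_num)
  simp only [Real.rpow_two] at hlc
  rw [hlc]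
  have htail : ∀ t ∈ Set.Ioi (0 : ℝ), (μ.restrict A) {x | t < max (g x - m - a) 0} *
      ENNReal.ofReal (t ^ ((2 : ℝ) - 1)) ≤
      ENNReal.ofReal (μ.real A) * ENNReal.ofReal (Real.exp (-(r * t ^ 2 / 2)) * t) := by
    intro t ht
    have ht : 0 < t := ht
    have hS : MeasurableSet {x | t < max (g x - m - a) 0} := measurableSet_lt measurable_const hfm
    rw [Measure.restrict_apply hS]
    have h1 : μ.real ({x | t < max (g x - m - a) 0} ∩ A) ≤
        Real.exp (-(r * ((m + a + t) - m) ^ 2 / 2)) := by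
      refine hT.measureReal_le hr hg hgi (hS.inter hA) (by linarith) fun x hx => ?_
      have hx1 : t < max (g x - m - a) 0 := hx.1
      rcases lt_max_iff.1 hx1 with h | h <;> linarith
    -- Use `(a + t)² ≥ a² + t²`; by the choice of `a`, `exp (-r a² / 2)` is exactly `μ(A)`, which
    -- supplies the factor `μ(A)` in the final bound.
    have h2 : Real.exp (-(r * ((m + a + t) - m) ^ 2 / 2)) ≤
        μ.real A * Real.exp (-(r * t ^ 2 / 2)) := by
      conv_rhs => rw [← Real.exp_log hA0]
      rw [← Real.exp_add, Real.exp_le_exp]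
      have : 0 ≤ r * (a * t) := by positivity
      nlinarith
    rw [← ofReal_measureReal, ← ENNReal.ofReal_mul (by positivity),
      ← ENNReal.ofReal_mul (by positivity)]
    refine ENNReal.ofReal_le_ofReal ?_
    rw [show (2 : ℝ) - 1 = 1 by norm_num, Real.rpow_one, ← mul_assoc]
    exact mul_le_mul_of_nonneg_right (h1.trans h2) ht.le
  refine (mul_le_mul_right (setLIntegral_mono' measurableSet_Ioi htail) _).trans ?_
  rw [lintegral_const_mul' _ _ ENNReal.ofReal_ne_top,
    ← ofReal_integral_eq_lintegral_ofReal (integrableOn_Ioi_mul_exp_neg_mul_sq hr),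
    integral_Ioi_mul_exp_neg_mul_sq hr, ← ENNReal.ofReal_mul (by positivity),
    ← ENNReal.ofReal_mul (by positivity)]
  · exact ENNReal.ofReal_le_ofReal (le_of_eq (by ring))
  · filter_upwards [ae_restrict_mem measurableSet_Ioi] with t ht
    have : 0 < t := ht
    positivity

end Concentration

/-! ### Determinants and second moments of affine images -/

/-- The Hilbert–Schmidt norm of an endomorphism of `ℝⁿ` controls its determinant. -/
theorem card_mul_abs_det_rpow_le (hn : 1 ≤ n)
    (M : EuclideanSpace ℝ (Fin n) →ₗ[ℝ] EuclideanSpace ℝ (Fin n)) :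
    n * (|LinearMap.det M| ^ (1 / (n : ℝ))) ^ 2 ≤
      ∑ i, ‖LinearMap.adjoint M (EuclideanSpace.basisFun (Fin n) ℝ i)‖ ^ 2 := by
  have hn0 : (0 : ℝ) < n := by exact_mod_cast hn
  set b := EuclideanSpace.basisFun (Fin n) ℝ
  set v : Fin n → EuclideanSpace ℝ (Fin n) := fun i => LinearMap.adjoint M (b i)
  have : Fact (Module.finrank ℝ (EuclideanSpace ℝ (Fin n)) = n) := ⟨by simp⟩
  have hdet : b.toBasis.det v = LinearMap.det M := by
    have h1 : v = LinearMap.adjoint M ∘ b.toBasis := by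
      funext i
      simp [v]
    rw [h1, Module.Basis.det_comp, Module.Basis.det_self, mul_one,
      ← LinearMap.det_toMatrix b.toBasis, LinearMap.toMatrix_adjoint,
      Matrix.det_conjTranspose, LinearMap.det_toMatrix]
    rfl
  -- Hadamard's inequality; AM-GM for the squared norms then finishes.
  have hle : |LinearMap.det M| ≤ ∏ i, ‖v i‖ := by
    rw [← hdet, ← b.toBasis.orientation.volumeForm_robust' b]
    exact Orientation.abs_volumeForm_apply_le _ v
  have hamgm := Real.geom_mean_le_arith_mean Finset.univ (fun _ : Fin n => (1 : ℝ))
    (fun i => ‖v i‖ ^ 2) (fun _ _ => zero_le_one) (by simpa using hn0) (fun _ _ => by positivity)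
  simp only [Real.rpow_one, one_mul, Finset.sum_const, Finset.card_univ, Fintype.card_fin,
    nsmul_eq_mul, mul_one] at hamgm
  rw [le_div_iff₀' hn0] at hamgm
  refine le_trans ?_ hamgm
  rw [Finset.prod_pow, Real.rpow_pow_comm (abs_nonneg _), one_div]
  gcongr

theorem affineEquiv_apply_eq (T : EuclideanSpace ℝ (Fin n) ≃ᵃ[ℝ] EuclideanSpace ℝ (Fin n))
    (y : EuclideanSpace ℝ (Fin n)) : T y = T.linear y + T 0 := by
  simpa using T.map_vadd 0 y

theorem setIntegral_affineEquiv_image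
    (T : EuclideanSpace ℝ (Fin n) ≃ᵃ[ℝ] EuclideanSpace ℝ (Fin n))
    {C : Set (EuclideanSpace ℝ (Fin n))} (hC : MeasurableSet C)
    (f : EuclideanSpace ℝ (Fin n) → ℝ) :
    ∫ x in T '' C, f x =
      |LinearMap.det (T.linear : EuclideanSpace ℝ (Fin n) →ₗ[ℝ] EuclideanSpace ℝ (Fin n))| *
        ∫ y in C, f (T y) := by
  set M : EuclideanSpace ℝ (Fin n) →L[ℝ] EuclideanSpace ℝ (Fin n) :=
    LinearMap.toContinuousLinearMap
      (T.linear : EuclideanSpace ℝ (Fin n) →ₗ[ℝ] EuclideanSpace ℝ (Fin n))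
  have hT : (T : EuclideanSpace ℝ (Fin n) → EuclideanSpace ℝ (Fin n)) = fun y => M y + T 0 :=
    funext fun y => affineEquiv_apply_eq T y
  rw [integral_image_eq_integral_abs_det_fderiv_smul volume (f' := fun _ => M) hC
    (fun x _ => by rw [hT]; exact (M.hasFDerivAt.add_const _).hasFDerivWithinAt)
    T.injective.injOn]
  simp only [smul_eq_mul]
  rw [integral_const_mul]
  rfl

/-- Among the affine images of a given volume, the isotropic ones have the least second moment. -/
theorem IsIsotropicWith.le_setIntegral_norm_sq (hn : 1 ≤ n)
    {C : Set (EuclideanSpace ℝ (Fin n))} {L : ℝ} (hL : IsIsotropicWith C L) (hC : IsCompact C)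
    (T : EuclideanSpace ℝ (Fin n) ≃ᵃ[ℝ] EuclideanSpace ℝ (Fin n)) :
    0 < volume.real (T '' C) ∧
      volume.real (T '' C) * (n * L ^ 2 * (volume.real (T '' C) ^ (1 / (n : ℝ))) ^ 2) ≤
        ∫ x in T '' C, ‖x‖ ^ 2 := by
  set M : EuclideanSpace ℝ (Fin n) →ₗ[ℝ] EuclideanSpace ℝ (Fin n) :=
    (T.linear : EuclideanSpace ℝ (Fin n) →ₗ[ℝ] EuclideanSpace ℝ (Fin n)) with hM
  have hvol : volume.real C = 1 := by simp [Measure.real, hL.volume_eq_one]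
  have hdet : volume.real (T '' C) = |LinearMap.det M| := by
    have := setIntegral_affineEquiv_image T hC.measurableSet (fun _ => 1)
    simpa [hvol, hM] using this
  have hpos : 0 < |LinearMap.det M| := abs_pos.2 (LinearEquiv.isUnit_det' T.linear).ne_zero
  refine ⟨hdet ▸ hpos, ?_⟩
  rw [hdet, setIntegral_affineEquiv_image T hC.measurableSet, ← hM]
  refine mul_le_mul_of_nonneg_left ?_ (abs_nonneg _)
  set b := EuclideanSpace.basisFun (Fin n) ℝ
  have hcont : ∀ {F : Type} [NormedAddCommGroup F] {f : EuclideanSpace ℝ (Fin n) → F},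
      Continuous f → IntegrableOn f C := fun hf => hf.continuousOn.integrableOn_compact hC
  have hTc : Continuous T := T.continuous_of_finiteDimensional
  -- The zero centroid kills the cross term, so the translation part of `T` only adds `β² ≥ 0`.
  have hcoord : ∀ i, L ^ 2 * ‖LinearMap.adjoint M (b i)‖ ^ 2 ≤
      ∫ y in C, (inner ℝ (b i) (T y)) ^ 2 := by
    intro i
    set w := LinearMap.adjoint M (b i)
    set β := inner ℝ (b i) (T 0)
    have h1 : ∀ y, (inner ℝ (b i) (T y)) ^ 2 =
        (inner ℝ y w) ^ 2 + (2 * β * inner ℝ w y + β ^ 2) := by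
      intro y
      rw [affineEquiv_apply_eq, inner_add_right, real_inner_comm w y,
        show inner ℝ (b i) (T.linear y) = inner ℝ w y from
          (LinearMap.adjoint_inner_left M y (b i)).symm]
      ring
    simp only [h1]
    rw [integral_add (hcont (by fun_prop)) (hcont (by fun_prop)),
      integral_add (hcont (by fun_prop)) (hcont (by fun_prop)), integral_const_mul,
      integral_inner (f := fun y => y) (hcont continuous_id) w, hL.centroid_eq_zero, hL.second_moment]
    simp [hvol]
    positivity
  calc n * L ^ 2 * (|LinearMap.det M| ^ (1 / (n : ℝ))) ^ 2
      = L ^ 2 * (n * (|LinearMap.det M| ^ (1 / (n : ℝ))) ^ 2) := by ring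
    _ ≤ L ^ 2 * ∑ i, ‖LinearMap.adjoint M (b i)‖ ^ 2 := by
        gcongr
        exact card_mul_abs_det_rpow_le hn M
    _ ≤ ∑ i, ∫ y in C, (inner ℝ (b i) (T y)) ^ 2 := by
        rw [Finset.mul_sum]
        exact Finset.sum_le_sum fun i _ => hcoord i
    _ = ∫ y in C, ‖T y‖ ^ 2 := by
        rw [← integral_finsetSum _ fun i _ => hcont (by fun_prop)]
        simp only [b.sum_sq_inner_right]

theorem uniformMeasure_eq_restrict {B : Set (EuclideanSpace ℝ (Fin n))} (h : volume B = 1) :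
    uniformMeasure B = volume.restrict B := by
  simp [uniformMeasure, ProbabilityTheory.cond, h]

/-! ### Second moments in an isotropic body -/

section Isotropic

variable {B : Set (EuclideanSpace ℝ (Fin n))} {L r : ℝ}

theorem IsIsotropicWith.isProbabilityMeasure (hL : IsIsotropicWith B L) :
    IsProbabilityMeasure (volume.restrict B) := ⟨by simp [hL.volume_eq_one]⟩

theorem IsIsotropicWith.integral_norm_sq (hL : IsIsotropicWith B L) (hB : IsCompact B) :
    ∫ x in B, ‖x‖ ^ 2 = n * L ^ 2 := by
  set b := EuclideanSpace.basisFun (Fin n) ℝ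
  simp only [← b.sum_sq_inner_left]
  rw [integral_finsetSum _ fun i _ => ContinuousOn.integrableOn_compact hB (by fun_prop)]
  simp [hL.second_moment]

/-- The isotropic constant of an isotropic body is controlled by concentration. -/
theorem IsIsotropicWith.sq_le (hn : 1 ≤ n) (hL : IsIsotropicWith B L) (hB : IsCompact B)
    (hT : SatisfiesT1 (volume.restrict B) (ENNReal.ofReal r)) (hr : 0 < r) :
    L ^ 2 ≤ 4 / r := by
  have := hL.isProbabilityMeasure
  obtain ⟨e, he⟩ : ∃ e : EuclideanSpace ℝ (Fin n), ‖e‖ = 1 :=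
    ⟨EuclideanSpace.basisFun (Fin n) ℝ ⟨0, hn⟩, by simp⟩
  have hcont : ∀ {F : Type} [NormedAddCommGroup F] {f : EuclideanSpace ℝ (Fin n) → F},
      Continuous f → Integrable f (volume.restrict B) :=
    fun hf => hf.continuousOn.integrableOn_compact hB
  have hside : ∀ u : EuclideanSpace ℝ (Fin n), ‖u‖ = 1 →
      ∫⁻ x in B, ENNReal.ofReal (max (inner ℝ u x) 0 ^ 2) ≤ ENNReal.ofReal (2 / r) := by
    intro u hu
    have hlip : LipschitzWith 1 fun x : EuclideanSpace ℝ (Fin n) => inner ℝ u x := by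
      refine LipschitzWith.of_dist_le_mul fun x y => ?_
      rw [Real.dist_eq, ← inner_sub_right, dist_eq_norm]
      simpa [hu] using abs_real_inner_le_norm u (x - y)
    have hmean : ∫ x in B, inner ℝ u x = 0 := by
      rw [integral_inner (f := fun x => x) (hcont continuous_id), hL.centroid_eq_zero, inner_zero_right]
    -- The whole space has probability `1`, so `a = 0` is admissible. This bounds the positive part
    -- only; `e` and `-e` together give the full second moment.
    have := hT.setLIntegral_sq_le hr hlip (hcont (by fun_prop)) MeasurableSet.univ
      (by simp) le_rfl (by simp)
    simpa [hmean] using this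
  have hsum : ENNReal.ofReal (L ^ 2) ≤ ENNReal.ofReal (4 / r) := by
    calc ENNReal.ofReal (L ^ 2) = ENNReal.ofReal (∫ x in B, (inner ℝ x e) ^ 2) := by
          rw [hL.second_moment, he, one_pow, mul_one]
      _ = ∫⁻ x in B, ENNReal.ofReal ((inner ℝ x e) ^ 2) :=
          ofReal_integral_eq_lintegral_ofReal (hcont (by fun_prop))
            (ae_of_all _ fun x => sq_nonneg _)
      _ ≤ ∫⁻ x in B, (ENNReal.ofReal (max (inner ℝ e x) 0 ^ 2) +
            ENNReal.ofReal (max (inner ℝ (-e) x) 0 ^ 2)) := by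
          refine lintegral_mono fun x => ?_
          rw [← ENNReal.ofReal_add (by positivity) (by positivity), inner_neg_left,
            real_inner_comm]
          refine ENNReal.ofReal_le_ofReal ?_
          rcases le_total 0 (inner ℝ e x) with h | h
          · rw [max_eq_left h]
            exact le_add_of_nonneg_right (sq_nonneg _)
          · rw [max_eq_left (neg_nonneg.2 h), neg_sq]
            exact le_add_of_nonneg_left (sq_nonneg _)
      _ ≤ ENNReal.ofReal (2 / r) + ENNReal.ofReal (2 / r) := by
          rw [lintegral_add_left (by fun_prop)]
          exact add_le_add (hside e he) (hside (-e) (by simpa using he))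
      _ = ENNReal.ofReal (4 / r) := by
          rw [← ENNReal.ofReal_add (by positivity) (by positivity)]
          congr 1
          ring
  exact (ENNReal.ofReal_le_ofReal_iff (by positivity)).1 hsum

/-- Second moment of a subset of an isotropic body, in terms of concentration. -/
theorem IsIsotropicWith.setIntegral_norm_sq_le (hn : 1 ≤ n) (hL : IsIsotropicWith B L)
    (hB : IsCompact B) (hT : SatisfiesT1 (volume.restrict B) (ENNReal.ofReal r)) (hr : 0 < r)
    {A : Set (EuclideanSpace ℝ (Fin n))} (hA : MeasurableSet A) (hAB : A ⊆ B)
    (hA0 : 0 < volume.real A) :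
    ∫ x in A, ‖x‖ ^ 2 ≤
      volume.real A * ((18 * n + 6 * -Real.log (volume.real A)) / r) := by
  have := hL.isProbabilityMeasure
  have hn1 : (1 : ℝ) ≤ n := by exact_mod_cast hn
  have hcont : ∀ {F : Type} [NormedAddCommGroup F] {f : EuclideanSpace ℝ (Fin n) → F},
      Continuous f → Integrable f (volume.restrict B) :=
    fun hf => hf.continuousOn.integrableOn_compact hB
  have hrestr : (volume.restrict B).restrict A = volume.restrict A := by
    rw [Measure.restrict_restrict hA, Set.inter_eq_self_of_subset_left hAB]
  have hreal : (volume.restrict B).real A = volume.real A := by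
    rw [measureReal_restrict_apply hA, Set.inter_eq_self_of_subset_left hAB]
  have hlog : 0 ≤ -Real.log (volume.real A) := by
    have := Real.log_nonpos hA0.le (hreal ▸ measureReal_le_one)
    linarith
  set m := ∫ x in B, ‖x‖ with hm
  have hm2 : m ^ 2 ≤ n * (4 / r) := by
    -- Nonnegativity of the variance of `‖x‖`.
    have h1 : m ^ 2 ≤ ∫ x in B, ‖x‖ ^ 2 := by
      have h2 : 0 ≤ ∫ x in B, (‖x‖ - m) ^ 2 := integral_nonneg fun _ => sq_nonneg _
      have h3 : ∀ x : EuclideanSpace ℝ (Fin n),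
          (‖x‖ - m) ^ 2 = ‖x‖ ^ 2 - (2 * m * ‖x‖ - m ^ 2) := fun x => by ring
      simp only [h3] at h2
      rw [integral_sub (hcont (by fun_prop)) (hcont (by fun_prop)),
        integral_sub (hcont (by fun_prop)) (hcont (by fun_prop)), integral_const_mul,
        ← hm] at h2
      simp only [integral_const, probReal_univ, one_smul] at h2
      nlinarith
    rw [hL.integral_norm_sq hB] at h1
    exact h1.trans (by gcongr; exact hL.sq_le hn hB hT hr)
  set a := √(2 / r * -Real.log (volume.real A)) with ha
  have ha2 : a ^ 2 = 2 / r * -Real.log (volume.real A) := Real.sq_sqrt (by positivity)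
  have key := hT.setLIntegral_sq_le hr lipschitzWith_one_norm (hcont continuous_norm) hA
    (by rwa [hreal]) (Real.sqrt_nonneg (2 / r * -Real.log (volume.real A)))
    (by rw [← ha, ha2, hreal]; field_simp)
  rw [hrestr, hreal, ← ha, ← hm] at key
  have hintA : ∀ {f : EuclideanSpace ℝ (Fin n) → ℝ}, Continuous f → IntegrableOn f A :=
    fun hf => (hf.continuousOn.integrableOn_compact hB).mono_set hAB
  rw [← ofReal_integral_eq_lintegral_ofReal (hintA (by fun_prop))
    (ae_of_all _ fun x => sq_nonneg _), ENNReal.ofReal_le_ofReal_iff (by positivity)] at key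
  calc ∫ x in A, ‖x‖ ^ 2
      -- From `(x + y + z)² ≤ 3 (x² + y² + z²)`; the constants become `18 = 3 · 4 + 3 · 2` and `6 =
      -- 3 · 2`.
      ≤ ∫ x in A, (3 * (m ^ 2 + a ^ 2) + 3 * max (‖x‖ - m - a) 0 ^ 2) := by
        refine integral_mono (hintA (by fun_prop)) (hintA (by fun_prop)) fun x => ?_
        have h1 : ‖x‖ ≤ m + a + max (‖x‖ - m - a) 0 := by
          have := le_max_left (‖x‖ - m - a) 0
          linarith
        have h2 : ‖x‖ ^ 2 ≤ (m + a + max (‖x‖ - m - a) 0) ^ 2 := by gcongr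
        have := sq_nonneg (m - a)
        have := sq_nonneg (m - max (‖x‖ - m - a) 0)
        have := sq_nonneg (a - max (‖x‖ - m - a) 0)
        simp only
        linarith
    _ = 3 * (m ^ 2 + a ^ 2) * volume.real A + 3 * ∫ x in A, max (‖x‖ - m - a) 0 ^ 2 := by
        rw [integral_add (hintA (by fun_prop)) (hintA (by fun_prop)), setIntegral_const,
          smul_eq_mul, mul_comm (volume.real A), ← integral_const_mul]
    _ ≤ 3 * (n * (4 / r) + 2 / r * -Real.log (volume.real A)) * volume.real A +
          3 * (n * (2 / r) * volume.real A) := by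
        rw [ha2]
        gcongr
        refine key.trans ?_
        gcongr
        exact le_mul_of_one_le_left (by positivity) hn1
    _ = _ := by ring

end Isotropic

/-! ### Comparison through the volume ratio -/

open Filter Topology

/-- A convex body can be mapped into any set with nonempty interior by an affine map. -/
theorem exists_affineEquiv_image_subset {K B : Set (EuclideanSpace ℝ (Fin n))}
    (hK : Bornology.IsBounded K) (hB : (interior B).Nonempty) :
    ∃ T : EuclideanSpace ℝ (Fin n) ≃ᵃ[ℝ] EuclideanSpace ℝ (Fin n), T '' K ⊆ B := by
  obtain ⟨x, hx⟩ := hB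
  obtain ⟨ε, hε, hball⟩ := Metric.mem_nhds_iff.1 (mem_interior_iff_mem_nhds.1 hx)
  obtain ⟨R, hR, hKR⟩ := hK.exists_pos_norm_le
  have hs : ε / (2 * R) ≠ 0 := by positivity
  refine ⟨(LinearEquiv.smulOfNeZero ℝ _ (ε / (2 * R)) hs).toAffineEquiv.trans
    (AffineEquiv.constVAdd ℝ _ x), ?_⟩
  rintro _ ⟨y, hy, rfl⟩
  refine hball ?_
  have h1 : ε / (2 * R) * ‖y‖ ≤ ε / (2 * R) * R := by gcongr; exact hKR y hy
  have h2 : ε / (2 * R) * R = ε / 2 := by field_simp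
  have h3 : |ε / (2 * R)| = ε / (2 * R) := abs_of_pos (by positivity)
  simp only [AffineEquiv.trans_apply, AffineEquiv.constVAdd_apply,
    LinearEquiv.coe_toAffineEquiv, LinearEquiv.smulOfNeZero_apply, vadd_eq_add,
    Metric.mem_ball, dist_eq_norm, add_sub_cancel_left, norm_smul, Real.norm_eq_abs, h3]
  linarith

section

variable {K B : Set (EuclideanSpace ℝ (Fin n))} {L LB : ℝ}

/-- The lower and upper second-moment bounds are compared on `T '' K`, viewed as an affine image of
the isotropic body `S '' K`. -/
theorem le_of_affine_image_subset (hn : 1 ≤ n) (hK : IsCompact K) (hB : IsCompact B)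
    (hLB : IsIsotropicWith B LB)
    {S : EuclideanSpace ℝ (Fin n) ≃ᵃ[ℝ] EuclideanSpace ℝ (Fin n)}
    (hS : IsIsotropicWith (S '' K) L)
    {T : EuclideanSpace ℝ (Fin n) ≃ᵃ[ℝ] EuclideanSpace ℝ (Fin n)} (hT : T '' K ⊆ B) {q : ℝ}
    (hq : q = (volume.real B / volume.real (T '' K)) ^ (1 / (n : ℝ))) :
    1 ≤ q ∧ ∀ r : ℝ, 0 < r → SatisfiesT1 (volume.restrict B) (ENNReal.ofReal r) →
      L * √r ≤ 5 * (1 + √(Real.log q)) * q := by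
  have hn0 : (0 : ℝ) < n := by exact_mod_cast hn
  have hSK : IsCompact (S '' K) := hK.image S.continuous_of_finiteDimensional
  have himg : (S.symm.trans T) '' (S '' K) = T '' K := by
    rw [Set.image_image]
    simp
  obtain ⟨hpos, hlow⟩ := hS.le_setIntegral_norm_sq hn hSK (S.symm.trans T)
  rw [himg] at hpos hlow
  have hvolB : volume.real B = 1 := by simp [Measure.real, hLB.volume_eq_one]
  set δ := volume.real (T '' K)
  have hδ1 : δ ≤ 1 := hvolB ▸ measureReal_mono hT hB.measure_lt_top.ne
  rw [hvolB] at hq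
  have hq1 : 1 ≤ q := by
    rw [hq]
    exact Real.one_le_rpow ((one_le_div hpos).2 hδ1) (by positivity)
  have hq0 : 0 < q := by linarith
  have hqinv : δ ^ (1 / (n : ℝ)) = q⁻¹ := by
    rw [hq, one_div δ, Real.inv_rpow hpos.le, inv_inv]
  have hlog : -Real.log δ = n * Real.log q := by
    rw [hq, Real.log_rpow (by positivity), one_div δ, Real.log_inv]
    field_simp
  refine ⟨hq1, fun r hr hT1 => ?_⟩
  have hup := hLB.setIntegral_norm_sq_le hn hB hT1 hr
    (hK.image T.continuous_of_finiteDimensional).measurableSet hT hpos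
  have hl0 : 0 ≤ Real.log q := Real.log_nonneg hq1
  have h1 := le_of_mul_le_mul_left (hlow.trans hup) hpos
  rw [hqinv, hlog] at h1
  have h2 : L ^ 2 * r ≤ (18 + 6 * Real.log q) * q ^ 2 := by
    rw [le_div_iff₀ hr] at h1
    have h3 : n * (L ^ 2 * r) ≤ n * ((18 + 6 * Real.log q) * q ^ 2) := by
      calc n * (L ^ 2 * r) = n * L ^ 2 * q⁻¹ ^ 2 * r * q ^ 2 := by field_simp
        _ ≤ (18 * n + 6 * (n * Real.log q)) * q ^ 2 := by gcongr
        _ = _ := by ring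
    exact le_of_mul_le_mul_left h3 hn0
  refine abs_le_of_sq_le_sq' ?_ (by positivity) |>.2
  rw [mul_pow, Real.sq_sqrt hr.le]
  refine h2.trans ?_
  rw [mul_pow]
  gcongr
  -- With `s = √(log q)`, `18 + 6 s² ≤ 25 (1 + s)²`.
  have hsq := Real.sq_sqrt hl0
  have := Real.sqrt_nonneg (Real.log q)
  nlinarith

theorem mul_sqrt_le_volumeRatio (hn : 1 ≤ n) (hK : IsCompact K) (hB : IsCompact B)
    (hBi : (interior B).Nonempty) (hLB : IsIsotropicWith B LB)
    {S : EuclideanSpace ℝ (Fin n) ≃ᵃ[ℝ] EuclideanSpace ℝ (Fin n)}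
    (hS : IsIsotropicWith (S '' K) L) :
    1 ≤ volumeRatio B K ∧
      ∀ r : ℝ, 0 < r → SatisfiesT1 (volume.restrict B) (ENNReal.ofReal r) →
        L * √r ≤ 5 * (1 + √(Real.log (volumeRatio B K))) * volumeRatio B K := by
  obtain ⟨T₀, hT₀⟩ := exists_affineEquiv_image_subset hK.isBounded hBi
  have hbdd : BddBelow {q : ℝ | ∃ T : EuclideanSpace ℝ (Fin n) ≃ᵃ[ℝ] EuclideanSpace ℝ (Fin n),
      T '' K ⊆ B ∧ q = (volume.real B / volume.real (T '' K)) ^ (1 / (n : ℝ))} := by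
    refine ⟨1, ?_⟩
    rintro q ⟨T, hT, hq⟩
    exact (le_of_affine_image_subset hn hK hB hLB hS hT hq).1
  -- A minimising sequence suffices, since the bound is continuous in `q` on `[1, ∞)`; attainment of
  -- the minimum is not needed.
  obtain ⟨u, -, hu, hmem⟩ := exists_seq_tendsto_sInf (by exact ⟨_, T₀, hT₀, rfl⟩) hbdd
  change Tendsto u atTop (𝓝 (volumeRatio B K)) at hu
  have hbound : ∀ k, 1 ≤ u k ∧
      ∀ r : ℝ, 0 < r → SatisfiesT1 (volume.restrict B) (ENNReal.ofReal r) →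
        L * √r ≤ 5 * (1 + √(Real.log (u k))) * u k := by
    intro k
    obtain ⟨T, hT, hq⟩ := hmem k
    exact le_of_affine_image_subset hn hK hB hLB hS hT hq
  have hv : 1 ≤ volumeRatio B K := ge_of_tendsto' hu fun k => (hbound k).1
  exact ⟨hv, fun r hr hT1 => ge_of_tendsto'
    ((((hu.log (by linarith)).sqrt.const_add 1).const_mul 5).mul hu)
    fun k => (hbound k).2 r hr hT1⟩

end

end Slicing

/-! ### Passage to the optimal transport constant -/

open Slicing in
theorem lemma1 :
    ∃ c : ℝ, 0 < c ∧
      ∀ (n : ℕ) (_ : 1 ≤ n) (K B : ConvexBody (EuclideanSpace ℝ (Fin n)))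
        (_ : (interior (K : Set (EuclideanSpace ℝ (Fin n)))).Nonempty)
        (_ : (interior (B : Set (EuclideanSpace ℝ (Fin n)))).Nonempty)
        (_ : Slicing.IsIsotropic (B : Set (EuclideanSpace ℝ (Fin n)))),
        ENNReal.ofReal (Slicing.isotropicConstant (K : Set (EuclideanSpace ℝ (Fin n)))) ≤
          ENNReal.ofReal
            (c * (1 + √(Real.log (Slicing.volumeRatio (B : Set (EuclideanSpace ℝ (Fin n))) K))) *
              Slicing.volumeRatio (B : Set (EuclideanSpace ℝ (Fin n))) K) *
          (Slicing.transportCostConst 1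
            (Slicing.uniformMeasure (B : Set (EuclideanSpace ℝ (Fin n))))) ^ (-(1 / 2) : ℝ) := by
  refine ⟨5, by norm_num, ?_⟩
  rintro n hn K B - hBi ⟨LB, hLB⟩
  have hK := K.isCompact
  have hB := B.isCompact
  set v := volumeRatio (B : Set (EuclideanSpace ℝ (Fin n))) K
  set X := 5 * (1 + √(Real.log v)) * v with hX
  rw [uniformMeasure_eq_restrict hLB.volume_eq_one]
  set τ := transportCostConst 1 (volume.restrict (B : Set (EuclideanSpace ℝ (Fin n)))) with hτ
  by_cases htop : ENNReal.ofReal X * τ ^ (-(1 / 2) : ℝ) = ∞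
  · rw [htop]
    exact le_top
  -- Bounding every admissible `L` bounds the supremum, so neither existence nor uniqueness of the
  -- isotropic position is needed.
  refine ENNReal.ofReal_le_of_le_toReal (Real.sSup_le ?_ ENNReal.toReal_nonneg)
  rintro L ⟨S, hS⟩
  refine (ENNReal.ofReal_le_iff_le_toReal htop).1 ?_
  obtain ⟨hv, hbound⟩ := mul_sqrt_le_volumeRatio hn hK hB hBi hLB hS
  have hL := hS.const_pos
  have hX0 : 0 < X := by positivity
  have hτX : τ ≤ ENNReal.ofReal ((X / L) ^ 2) := by
    -- Approximating `σ` from below by finite `r` also covers `σ = ∞`.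
    refine sSup_le fun σ hσ => ENNReal.le_of_forall_nnreal_lt fun r hr => ?_
    rcases eq_or_ne r 0 with rfl | hr0
    · simp
    have hr1 : (0 : ℝ) < r := by positivity
    have hT1 : SatisfiesT1 (volume.restrict (B : Set (EuclideanSpace ℝ (Fin n)))) σ := hσ
    have h1 := hbound r hr1 (hT1.mono (by simpa using hr.le))
    have h2 : √(r : ℝ) ≤ X / L := by
      rw [le_div_iff₀' hL]
      exact h1
    rw [← ENNReal.ofReal_coe_nnreal]
    exact ENNReal.ofReal_le_ofReal ((Real.sqrt_le_left (by positivity)).1 h2)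
  have hτs : τ ^ (1 / 2 : ℝ) ≤ ENNReal.ofReal (X / L) := by
    refine (ENNReal.rpow_le_rpow hτX (by norm_num)).trans_eq ?_
    rw [ENNReal.ofReal_rpow_of_nonneg (by positivity) (by norm_num), ← Real.sqrt_eq_rpow,
      Real.sqrt_sq (by positivity)]
  calc ENNReal.ofReal L = ENNReal.ofReal X * (ENNReal.ofReal (X / L))⁻¹ := by
        rw [← ENNReal.ofReal_inv_of_pos (by positivity), ← ENNReal.ofReal_mul hX0.le]
        congr 1
        field_simp
    _ ≤ ENNReal.ofReal X * τ ^ (-(1 / 2) : ℝ) := by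
        rw [ENNReal.rpow_neg]
        gcongr
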